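/- For an infinite sequence $T=(t_n)_{n\ge 1}$ of positive integers, let $w_0$ be the empty word and, for $k\ge 1$, let $w_k$ be obtained from $w_{k-1}$ by appending one letter $t_k$ and then $x-1$ further copies of $t_k$, where $x$ is the $k$-th letter of the word $w_{k-1}t_k$. Each $w_k$ is a prefix of $w_{k+1}$ and $|w_k|\ge k$; the sequence directed by $T$ is the infinite sequence $\mathcal O_T=\lim_{k\to\infty} w_k$. Thus the $k$-th block of $\mathcal O_T=(x_n)_{n\ge1}$ has length $x_k$ and is filled with the letter $t_k$. Theorem. Let $a\ge 2$ be an integer, let $p\in(0,1)$, and let $\mathbb T=(T_n)_{n\ge 1}$ be a Markov chain over the alphabet $\{1,a\}$ with initial value $T_1=1$ and with transition probability $p$ from $1$ to $a$ and from $a$ to $1$. Let $\mathbb X=(X_n)_{n\ge1}=\mathcal O_{\mathbb T}$ be the random sequence directed by $\mathbb T$, and let $|X_1\cdots X_n|_1$ denote the number of indices $i\le n$ with $X_i=1$. Then $$\lim_{n\to\infty}\mathbb P(X_n=1)=\frac12\qquad\text{and}\qquad \lim_{n\to\infty}\frac{\mathbb E\big(|X_1\cdots X_n|_1\big)}{n}=\frac12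 .$$ -/

import Mathlib

/-- The finite word `O_{t₁ ⋯ t_k}` directed by the first `k` letters of `t`, where `t i` is the
`(i+1)`-st letter of the directing sequence.  At step `k + 1` the letter `t k` is written once at
the end of the current word `w`, which gives a word `v` having at least `k + 1` letters; if `x` is
the `(k+1)`-st letter of `v`, then `x - 1` further copies of `t k` are written, so that the
`(k+1)`-st block is filled with `t k` and has length `x` (letters are positive integers).
The default value of `getD` is never used, see `le_length_directedWord`. -/
def directedWord (t : ℕ → ℕ) : ℕ → List ℕ
  | 0 => []
  | k + 1 =>
    let v := directedWord t k ++ [t k]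
    v ++ List.replicate (v.getD k 0 - 1) (t k)

theorem le_length_directedWord (t : ℕ → ℕ) (k : ℕ) : k ≤ (directedWord t k).length := by
  induction k with
  | zero => simp
  | succ k ih => simp only [directedWord, List.length_append, List.length_singleton]; omega

theorem directedWord_prefix (t : ℕ → ℕ) {j k : ℕ} (h : j ≤ k) :
    directedWord t j <+: directedWord t k := by
  induction k, h using Nat.le_induction with
  | base => exact List.prefix_refl _
  | succ k _ ih =>
    refine ih.trans ?_
    simp only [directedWord, List.append_assoc]
    exact List.prefix_append _ _

/-- The infinite sequence `O_T` directed by `t`, the limit of the words `directedWord t k`: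
`directedSeq t n` is its `(n+1)`-st letter. -/
def directedSeq (t : ℕ → ℕ) (n : ℕ) : ℕ :=
  (directedWord t (n + 1)).getD n 0

/-- Every word `directedWord t k` is a prefix of `directedSeq t`. -/
theorem getElem_directedWord (t : ℕ → ℕ) {n k : ℕ} (h : n < (directedWord t k).length) :
    (directedWord t k)[n] = directedSeq t n := by
  have h' : n < (directedWord t (n + 1)).length := le_length_directedWord t (n + 1)
  rw [directedSeq, List.getD_eq_getElem _ _ h']
  rcases le_total k (n + 1) with hk | hk
  · exact (directedWord_prefix t hk).getElem h
  · exact ((directedWord_prefix t hk).getElem h').symm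

/-- The number `|x₁ ⋯ x_n|_c` of occurrences of `c` among the first `n` letters of `x`
(`x i` is the `(i+1)`-st letter). -/
def letterCount (x : ℕ → ℕ) (c n : ℕ) : ℕ :=
  ((Finset.range n).filter (fun i => x i = c)).card

/-- `T 0, T 1, …` is a time-homogeneous Markov chain under `μ` with initial value `s₀` and
transition probabilities `K x y` (from `x` to `y`), on a countable discrete state space `S`: given
any history of positive probability ending in `x`, the next state is `y` with conditional
probability `K x y`. -/
structure IsMarkovChain {Ω S : Type*} [MeasurableSpace Ω] [MeasurableSpace S]
    [Countable S] [MeasurableSingletonClass S]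
    (μ : MeasureTheory.Measure Ω) (K : S → S → ℝ) (s₀ : S) (T : ℕ → Ω → S) : Prop where
  measurable : ∀ n, Measurable (T n)
  initial : ∀ᵐ ω ∂μ, T 0 ω = s₀
  transition : ∀ (n : ℕ) (s : ℕ → S) (y : S),
    μ {ω | ∀ i ≤ n, T i ω = s i} ≠ 0 →
      (ProbabilityTheory.cond μ {ω | ∀ i ≤ n, T i ω = s i}).real {ω | T (n + 1) ω = y}
        = K (s n) y

/-- The transition probabilities of the symmetric chain on `{1, a}`: from each of the two letters
the chain moves to the other one with probability `p` and stays with probability `1 - p`. -/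
def flipKernel (a : ℕ) (p : ℝ) (x y : ({1, a} : Set ℕ)) : ℝ :=
  if x = y then 1 - p else p

/-!
Since `O_T` contains letters larger than `1` infinitely often, the word `w_k` is longer than `k` by
an amount tending to infinity. For fixed `m` and large `n`, the block containing position `n`
therefore has its place and length determined by the directing letters that precede its own letter
by at least `m` steps. Conditionally on these letters, the letter of the block is the state of
the chain after `m` steps with no constraint on the way, so its law is close to the limit of
`K ^ m`.
-/

open MeasureTheory Filter Topology

section DirectedSequence

variable {t t' : ℕ → ℕ}

theorem dependsOn_directedWord (k : ℕ) :
    DependsOn (fun t : ℕ → ℕ => directedWord t k) (Set.Iio k) := by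
  intro t t' h
  induction k with
  | zero => rfl
  | succ k ih =>
    have hword : directedWord t k = directedWord t' k :=
      ih fun i hi => h i (hi.trans k.lt_succ_self)
    simp only [directedWord, hword, h k k.lt_succ_self]

theorem directedSeq_congr {j n : ℕ} (h : directedWord t j = directedWord t' j)
    (hn : n < (directedWord t j).length) : directedSeq t n = directedSeq t' n := by
  rw [← getElem_directedWord t hn, ← getElem_directedWord t' (h ▸ hn)]
  simp only [h]

theorem dependsOn_directedSeq (n : ℕ) :
    DependsOn (fun t : ℕ → ℕ => directedSeq t n) (Set.Iic n) := fun t _ h =>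
  directedSeq_congr (dependsOn_directedWord (n + 1) fun i hi => h i (Nat.le_of_lt_succ hi))
    (le_length_directedWord t (n + 1))

-- The truncated `x - 1 + 1` is `x` for a positive letter `x`; a letter `0` also gives length `1`.
theorem directedWord_succ (t : ℕ → ℕ) (k : ℕ) :
    directedWord t (k + 1) =
      directedWord t k ++ List.replicate (directedSeq t k - 1 + 1) (t k) := by
  have hk : k < (directedWord t k ++ [t k]).length := by
    simpa [Nat.lt_succ_iff] using le_length_directedWord t k
  have hprefix : directedWord t k ++ [t k] <+: directedWord t (k + 1) := List.prefix_append _ _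
  have hx : (directedWord t k ++ [t k]).getD k 0 = directedSeq t k := by
    rw [List.getD_eq_getElem _ _ hk, hprefix.getElem hk, getElem_directedWord]
  simp only [directedWord, hx, List.replicate_succ, List.append_assoc, List.singleton_append]

theorem length_directedWord_succ (t : ℕ → ℕ) (k : ℕ) :
    (directedWord t (k + 1)).length = (directedWord t k).length + (directedSeq t k - 1 + 1) := by
  rw [directedWord_succ, List.length_append, List.length_replicate]

theorem strictMono_length_directedWord (t : ℕ → ℕ) :
    StrictMono fun k => (directedWord t k).length :=
  strictMono_nat_of_lt_succ fun k => by simp only [length_directedWord_succ]; omega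

theorem length_directedWord_congr {k : ℕ} (h : ∀ i < k, directedSeq t i = directedSeq t' i) :
    (directedWord t k).length = (directedWord t' k).length := by
  induction k with
  | zero => rfl
  | succ k ih =>
    rw [length_directedWord_succ, length_directedWord_succ, h k k.lt_succ_self,
      ih fun i hi => h i (hi.trans k.lt_succ_self)]

theorem directedSeq_eq_of_mem_block {k n : ℕ} (hkn : (directedWord t k).length ≤ n)
    (hnk : n < (directedWord t (k + 1)).length) : directedSeq t n = t k := by
  rw [← getElem_directedWord t hnk]
  simp only [directedWord_succ, List.getElem_append_right hkn, List.getElem_replicate]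

theorem directedSeq_length_directedWord (t : ℕ → ℕ) (k : ℕ) :
    directedSeq t (directedWord t k).length = t k :=
  directedSeq_eq_of_mem_block le_rfl (strictMono_length_directedWord t k.lt_succ_self)

theorem frequently_lt_directedSeq {b : ℕ} (ht : ∃ᶠ i in atTop, b < t i) :
    ∃ᶠ n in atTop, b < directedSeq t n :=
  (strictMono_length_directedWord t).tendsto_atTop.frequently <|
    ht.mono fun i hi => (directedSeq_length_directedWord t i).symm ▸ hi

theorem tendsto_length_directedWord_sub (ht : ∃ᶠ i in atTop, 1 < t i) :
    Tendsto (fun k => (directedWord t k).length - k) atTop atTop := by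
  have hmono : Monotone fun k => (directedWord t k).length - k :=
    monotone_nat_of_le_succ fun k => by simp only [length_directedWord_succ]; omega
  refine tendsto_atTop_atTop_of_monotone hmono fun b => ?_
  induction b with
  | zero => exact ⟨0, Nat.zero_le _⟩
  | succ b ih =>
    obtain ⟨k, hk⟩ := ih
    obtain ⟨i, hki, hi⟩ := frequently_atTop.mp (frequently_lt_directedSeq ht) k
    have hbi : b ≤ (directedWord t i).length - i := hk.trans (hmono hki)
    have hlength := le_length_directedWord t i
    exact ⟨i + 1, by rw [length_directedWord_succ]; omega⟩

/-- The index of the block of `directedSeq t` that contains position `n`; blocks and positions are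
both counted from `0`. -/
def blockIndex (t : ℕ → ℕ) (n : ℕ) : ℕ :=
  Nat.find (p := fun k => n < (directedWord t (k + 1)).length) ⟨n, le_length_directedWord t (n + 1)⟩

theorem blockIndex_le (t : ℕ → ℕ) (n : ℕ) : blockIndex t n ≤ n :=
  Nat.find_le (le_length_directedWord t (n + 1))

theorem blockIndex_eq_iff {n k : ℕ} : blockIndex t n = k ↔
    (directedWord t k).length ≤ n ∧ n < (directedWord t (k + 1)).length := by
  rw [blockIndex, Nat.find_eq_iff, and_comm]
  refine and_congr_left fun _ => ⟨fun h => ?_, fun hkn i hik => not_lt.mpr ?_⟩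
  · cases k with
    | zero => exact Nat.zero_le n
    | succ k => exact not_lt.mp (h k k.lt_succ_self)
  · exact ((strictMono_length_directedWord t).monotone (Nat.succ_le_of_lt hik)).trans hkn

theorem directedSeq_eq_apply_blockIndex (t : ℕ → ℕ) (n : ℕ) :
    directedSeq t n = t (blockIndex t n) :=
  have hblock := blockIndex_eq_iff.mp (rfl : blockIndex t n = blockIndex t n)
  directedSeq_eq_of_mem_block hblock.1 hblock.2

theorem tendsto_blockIndex (t : ℕ → ℕ) : Tendsto (blockIndex t) atTop atTop := by
  refine tendsto_atTop.mpr fun b => ?_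
  filter_upwards [eventually_ge_atTop (directedWord t b).length] with n hn
  refine (Nat.le_find_iff _ _).mpr fun k hk => not_lt.mpr ?_
  exact ((strictMono_length_directedWord t).monotone (Nat.succ_le_of_lt hk)).trans hn

/-- The event that position `n` lies in block `j + m` and that this is already decided by the first
`j + 1` letters of the directing sequence `t`: the condition on the length says that these determine
the first `j + m + 1` letters of `directedSeq t`, hence the lengths of the blocks `0, …, j + m`.
The letter at position `n` is then `t (j + m)`, read `m` steps after the last revealed letter `t j`.
-/
def IsEarlyBlock (m n j : ℕ) (t : ℕ → ℕ) : Prop :=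
  j + m < (directedWord t (j + 1)).length ∧ blockIndex t n = j + m

theorem dependsOn_isEarlyBlock (m n j : ℕ) : DependsOn (IsEarlyBlock m n j) (Set.Iic j) := by
  intro t t' h
  have hword : directedWord t (j + 1) = directedWord t' (j + 1) :=
    dependsOn_directedWord (j + 1) fun i hi => h i (Nat.le_of_lt_succ hi)
  simp only [IsEarlyBlock, ← hword, eq_iff_iff, and_congr_right_iff]
  intro hlt
  have hseq : ∀ i < j + m + 1, directedSeq t i = directedSeq t' i := fun i hi =>
    directedSeq_congr hword (by omega)
  rw [blockIndex_eq_iff, blockIndex_eq_iff, length_directedWord_congr hseq,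
    length_directedWord_congr fun i hi => hseq i (by omega)]

theorem IsEarlyBlock.directedSeq_eq {m n j : ℕ} (h : IsEarlyBlock m n j t) :
    directedSeq t n = t (j + m) :=
  h.2 ▸ directedSeq_eq_apply_blockIndex t n

theorem IsEarlyBlock.unique {m n j j' : ℕ} (h : IsEarlyBlock m n j t)
    (h' : IsEarlyBlock m n j' t) : j = j' :=
  Nat.add_right_cancel (h.2.symm.trans h'.2)

theorem eventually_exists_isEarlyBlock (ht : ∃ᶠ i in atTop, 1 < t i) (m : ℕ) :
    ∀ᶠ n in atTop, ∃ j ≤ n, IsEarlyBlock m n j t := by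
  have hlong : ∀ᶠ j in atTop, m ≤ (directedWord t (j + 1)).length - (j + 1) :=
    (tendsto_add_atTop_nat 1).eventually
      ((tendsto_length_directedWord_sub ht).eventually_ge_atTop m)
  filter_upwards [(tendsto_blockIndex t).eventually_ge_atTop m,
    ((tendsto_sub_atTop_nat m).comp (tendsto_blockIndex t)).eventually hlong] with n hmn hlength
  have hle := blockIndex_le t n
  have hword := le_length_directedWord t (blockIndex t n - m + 1)
  simp only [Function.comp_apply] at hlength
  exact ⟨blockIndex t n - m, by omega, by omega, by omega⟩

end DirectedSequence

section MarkovChain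

theorem dependsOn_forall_mem_eq {ι S : Type*} (I : Set ι) (r : ι → S) :
    DependsOn (fun s : ι → S => ∀ i ∈ I, s i = r i) I :=
  fun _ _ h => propext (forall₂_congr fun i hi => by rw [h i hi])

variable {Ω S : Type*} [MeasurableSpace Ω] {μ : Measure Ω} [MeasurableSpace S]
  [MeasurableSingletonClass S]

theorem measurable_comp_of_dependsOn [Countable S] {ι β : Type*} [MeasurableSpace β] [Nonempty β]
    {T : ι → Ω → S} (hT : ∀ i, Measurable (T i)) {I : Set ι} [Finite I] {f : (ι → S) → β}
    (hf : DependsOn f I) : Measurable fun ω => f fun i => T i ω := by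
  obtain ⟨g, rfl⟩ := dependsOn_iff_exists_comp.mp hf
  exact (measurable_of_countable g).comp (measurable_pi_lambda _ fun i : I => hT i)

theorem measurableSet_of_dependsOn [Countable S] {ι : Type*} {T : ι → Ω → S}
    (hT : ∀ i, Measurable (T i)) {I : Set ι} [Finite I] {A : (ι → S) → Prop} (hA : DependsOn A I) :
    MeasurableSet {ω | A fun i => T i ω} :=
  measurableSet_setOfPred.mpr (measurable_comp_of_dependsOn hT hA)

theorem sum_finset_measureReal_inter_preimage_singleton [IsFiniteMeasure μ] {f : Ω → S}
    (hf : Measurable f) (A : Set Ω) (F : Finset S) :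
    ∑ x ∈ F, μ.real (A ∩ f ⁻¹' {x}) = μ.real (A ∩ f ⁻¹' F) := by
  have h := sum_measureReal_preimage_singleton (μ := μ.restrict A) F
    fun x _ => hf (measurableSet_singleton x)
  simpa only [measureReal_restrict_apply, hf (measurableSet_singleton _), hf F.measurableSet,
    Set.inter_comm _ A] using h

theorem sum_measureReal_inter_preimage_singleton [IsFiniteMeasure μ] [Fintype S] {f : Ω → S}
    (hf : Measurable f) (A : Set Ω) : ∑ x, μ.real (A ∩ f ⁻¹' {x}) = μ.real A := by
  rw [sum_finset_measureReal_inter_preimage_singleton hf, Finset.coe_univ, Set.preimage_univ,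
    Set.inter_univ]

namespace IsMarkovChain

variable {K : S → S → ℝ} {s₀ : S} {T : ℕ → Ω → S} {A : (ℕ → S) → Prop} {n : ℕ}

variable [IsFiniteMeasure μ]

theorem measureReal_inter_of_history [Countable S] (hT : IsMarkovChain μ K s₀ T) (n : ℕ)
    (s : ℕ → S) (y : S) :
    μ.real ({ω | ∀ i ≤ n, T i ω = s i} ∩ T (n + 1) ⁻¹' {y}) =
      μ.real {ω | ∀ i ≤ n, T i ω = s i} * K (s n) y := by
  have hmeas : MeasurableSet {ω | ∀ i ≤ n, T i ω = s i} :=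
    measurableSet_of_dependsOn hT.measurable (dependsOn_forall_mem_eq (Set.Iic n) s)
  by_cases h0 : μ {ω | ∀ i ≤ n, T i ω = s i} = 0
  · rw [measureReal_def, measureReal_def, measure_inter_null_of_null_left _ h0, h0]
    simp
  rw [← hT.transition n s y h0, mul_comm, measureReal_def, measureReal_def, measureReal_def,
    ← ENNReal.toReal_mul, ProbabilityTheory.cond_mul_eq_inter hmeas]
  rfl

theorem measureReal_inter_succ [Finite S] (hT : IsMarkovChain μ K s₀ T)
    (hA : DependsOn A (Set.Iic n)) {x : S} (hx : ∀ s, A s → s n = x) (y : S) :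
    μ.real ({ω | A fun i => T i ω} ∩ T (n + 1) ⁻¹' {y}) =
      μ.real {ω | A fun i => T i ω} * K x y := by
  let history : Ω → Set.Iic n → S := fun ω => (Set.Iic n).domRestrict fun i => T i ω
  have hhistory : Measurable history := measurable_pi_lambda _ fun i => hT.measurable i
  let F : Finset (Set.Iic n → S) :=
    (Set.toFinite {h | ∃ s, A s ∧ (Set.Iic n).domRestrict s = h}).toFinset
  have hF : history ⁻¹' F = {ω | A fun i => T i ω} := by
    ext ω
    simp only [F, Set.Finite.coe_toFinset]
    refine ⟨fun ⟨s, hs, hsω⟩ => ?_, fun hω => ⟨_, hω, rfl⟩⟩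
    exact (hA fun i hi => congrFun hsω ⟨i, hi⟩).mp hs
  have hstep : ∀ h ∈ F, μ.real (T (n + 1) ⁻¹' {y} ∩ history ⁻¹' {h}) =
      μ.real (history ⁻¹' {h}) * K x y := by
    intro h hh
    obtain ⟨s, hs, rfl⟩ := (Set.Finite.mem_toFinset _).mp hh
    have hcylinder : history ⁻¹' {(Set.Iic n).domRestrict s} = {ω | ∀ i ≤ n, T i ω = s i} := by
      ext ω
      exact funext_iff.trans Subtype.forall
    rw [Set.inter_comm, hcylinder, hT.measureReal_inter_of_history, hx s hs]
  rw [← hF, Set.inter_comm, ← sum_finset_measureReal_inter_preimage_singleton hhistory,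
    Finset.sum_congr rfl hstep, ← Finset.sum_mul,
    sum_measureReal_preimage_singleton _ fun h _ => hhistory (measurableSet_singleton h)]

theorem measureReal_inter_add [Fintype S] [DecidableEq S] (hT : IsMarkovChain μ K s₀ T)
    (hA : DependsOn A (Set.Iic n)) (m : ℕ) (y : S) :
    μ.real ({ω | A fun i => T i ω} ∩ T (n + m) ⁻¹' {y}) =
      ∑ x, μ.real ({ω | A fun i => T i ω} ∩ T n ⁻¹' {x}) * (Matrix.of K ^ m) x y := by
  induction m generalizing y with
  | zero => simp [Matrix.one_apply]
  | succ m ih =>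
    have hstep : ∀ z, μ.real ({ω | A fun i => T i ω} ∩ T (n + m + 1) ⁻¹' {y} ∩ T (n + m) ⁻¹' {z}) =
        μ.real ({ω | A fun i => T i ω} ∩ T (n + m) ⁻¹' {z}) * K z y := fun z => by
      have hAz : DependsOn (fun s : ℕ → S => A s ∧ s (n + m) = z) (Set.Iic (n + m)) :=
        fun s s' h => congrArg₂ And (hA fun i hi => h i (hi.trans (n.le_add_right m)))
          (by rw [h (n + m) (Set.mem_Iic.mpr le_rfl)])
      rw [Set.inter_right_comm]
      exact hT.measureReal_inter_succ hAz (fun _ hs => hs.2) y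
    rw [← add_assoc, ← sum_measureReal_inter_preimage_singleton (hT.measurable (n + m))]
    simp_rw [hstep, ih, pow_succ, Matrix.mul_apply, Matrix.of_apply, Finset.sum_mul, Finset.mul_sum,
      mul_assoc]
    exact Finset.sum_comm

theorem abs_measureReal_inter_add_sub_le [Fintype S] [DecidableEq S] (hT : IsMarkovChain μ K s₀ T)
    (hA : DependsOn A (Set.Iic n)) {m : ℕ} {y : S} {q ε : ℝ}
    (hK : ∀ x, |(Matrix.of K ^ m) x y - q| ≤ ε) :
    |μ.real ({ω | A fun i => T i ω} ∩ T (n + m) ⁻¹' {y}) - μ.real {ω | A fun i => T i ω} * q| ≤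
      μ.real {ω | A fun i => T i ω} * ε := by
  rw [hT.measureReal_inter_add hA,
    ← sum_measureReal_inter_preimage_singleton (hT.measurable n) {ω | A fun i => T i ω},
    Finset.sum_mul, Finset.sum_mul, ← Finset.sum_sub_distrib]
  refine (Finset.abs_sum_le_sum_abs _ _).trans (Finset.sum_le_sum fun x _ => ?_)
  rw [← mul_sub, abs_mul, abs_of_nonneg measureReal_nonneg]
  exact mul_le_mul_of_nonneg_left (hK x) measureReal_nonneg

theorem measureReal_forall_mem_Icc_succ [Finite S] (hT : IsMarkovChain μ K s₀ T) (x : S)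
    (N m : ℕ) :
    μ.real {ω | ∀ i ∈ Set.Icc N (N + m + 1), T i ω = x} =
      μ.real {ω | ∀ i ∈ Set.Icc N (N + m), T i ω = x} * K x x := by
  have hdep : DependsOn (fun s : ℕ → S => ∀ i ∈ Set.Icc N (N + m), s i = x) (Set.Iic (N + m)) :=
    (dependsOn_forall_mem_eq _ fun _ => x).mono Set.Icc_subset_Iic_self
  rw [← hT.measureReal_inter_succ hdep (fun s hs => hs _ ⟨le_self_add, le_rfl⟩) x]
  congr 1
  ext ω
  refine ⟨fun h => ⟨fun i hi => h i ⟨hi.1, hi.2.trans (Nat.le_succ _)⟩, h _ ⟨by omega, le_rfl⟩⟩,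
    fun ⟨hrun, hlast⟩ i hi => ?_⟩
  rcases Nat.le_succ_iff.mp hi.2 with hle | rfl
  · exact hrun i ⟨hi.1, hle⟩
  · exact hlast

theorem measure_forall_ge_eq [Finite S] (hT : IsMarkovChain μ K s₀ T) {x : S} (hx : K x x ≠ 1)
    (N : ℕ) : μ {ω | ∀ i ≥ N, T i ω = x} = 0 := by
  let run : ℕ → Set Ω := fun m => {ω | ∀ i ∈ Set.Icc N (N + m), T i ω = x}
  have hmeas : ∀ m, MeasurableSet (run m) := fun m =>
    measurableSet_of_dependsOn hT.measurable (dependsOn_forall_mem_eq _ fun _ => x)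
  have hanti : Antitone run := fun m m' hm ω hω i hi => hω i ⟨hi.1, hi.2.trans (by omega)⟩
  have hlim : Tendsto (fun m => μ.real (run m)) atTop (𝓝 (μ.real (⋂ m, run m))) :=
    (ENNReal.tendsto_toReal (measure_ne_top _ _)).comp <| tendsto_measure_iInter_atTop
      (fun m => (hmeas m).nullMeasurableSet) hanti ⟨0, measure_ne_top _ _⟩
  have hfix : μ.real (⋂ m, run m) = μ.real (⋂ m, run m) * K x x :=
    tendsto_nhds_unique ((tendsto_add_atTop_iff_nat 1).mpr hlim)
      ((hlim.mul_const (K x x)).congr fun m => (hT.measureReal_forall_mem_Icc_succ x N m).symm)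
  have hzero : μ.real (⋂ m, run m) = 0 := by
    by_contra hne
    exact hx ((mul_eq_left₀ hne).mp hfix.symm)
  refine measure_mono_null (fun ω hω => ?_) ((measureReal_eq_zero_iff).mp hzero)
  exact Set.mem_iInter.mpr fun m i hi => hω i hi.1

theorem ae_frequently_ne [Finite S] (hT : IsMarkovChain μ K s₀ T) {x : S} (hx : K x x ≠ 1) :
    ∀ᵐ ω ∂μ, ∃ᶠ i in atTop, T i ω ≠ x := by
  simp_rw [frequently_atTop]
  refine ae_all_iff.mpr fun N => ?_
  simpa [ae_iff] using hT.measure_forall_ge_eq hx N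

end IsMarkovChain

end MarkovChain

theorem abs_measureReal_sub_le_of_pairwiseDisjoint {Ω ι : Type*} [MeasurableSpace Ω] {μ : Measure Ω}
    [IsProbabilityMeasure μ] {F : Finset ι} {E : ι → Set Ω}
    (hdisj : (F : Set ι).PairwiseDisjoint E) (hE : ∀ j ∈ F, MeasurableSet (E j)) {B : Set Ω}
    {q ε : ℝ} (hB : ∀ j ∈ F, |μ.real (E j ∩ B) - μ.real (E j) * q| ≤ μ.real (E j) * ε)
    (hε : 0 ≤ ε) :
    |μ.real B - q| ≤ ε + (1 + |q|) * μ.real (⋃ j ∈ F, E j)ᶜ := by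
  set G := ⋃ j ∈ F, E j
  have hG : MeasurableSet G := F.measurableSet_biUnion hE
  have hsum : μ.real G = ∑ j ∈ F, μ.real (E j) := measureReal_biUnion_finset hdisj hE
  have hsumB : μ.real (G ∩ B) = ∑ j ∈ F, μ.real (E j ∩ B) := by
    rw [← measureReal_restrict_apply hG, measureReal_biUnion_finset hdisj hE]
    exact Finset.sum_congr rfl fun j hj => measureReal_restrict_apply (hE j hj)
  have hinside : |μ.real (G ∩ B) - μ.real G * q| ≤ ε := by
    rw [hsumB, hsum, Finset.sum_mul, ← Finset.sum_sub_distrib]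
    calc _ ≤ ∑ j ∈ F, μ.real (E j) * ε :=
          (Finset.abs_sum_le_sum_abs _ _).trans (Finset.sum_le_sum hB)
      _ = μ.real G * ε := by rw [← Finset.sum_mul, hsum]
      _ ≤ ε := mul_le_of_le_one_left hε measureReal_le_one
  have houtside : |μ.real (B \ G) - μ.real Gᶜ * q| ≤ (1 + |q|) * μ.real Gᶜ := by
    have hle : μ.real (B \ G) ≤ μ.real Gᶜ := measureReal_mono fun _ hω => hω.2
    calc _ ≤ |μ.real (B \ G)| + |μ.real Gᶜ * q| := abs_sub _ _
      _ = μ.real (B \ G) + μ.real Gᶜ * |q| := by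
        rw [abs_mul, abs_of_nonneg measureReal_nonneg, abs_of_nonneg measureReal_nonneg]
      _ ≤ (1 + |q|) * μ.real Gᶜ := by linarith
  have hsplit : μ.real B - q =
      (μ.real (G ∩ B) - μ.real G * q) + (μ.real (B \ G) - μ.real Gᶜ * q) := by
    have hcompl := probReal_add_probReal_compl (μ := μ) hG
    rw [Set.inter_comm]
    linear_combination -(measureReal_inter_add_sdiff (μ := μ) (s := B) hG) + q * hcompl
  exact hsplit ▸ (abs_add_le _ _).trans (add_le_add hinside houtside)

theorem tendsto_integral_letterCount_div {Ω : Type*} [MeasurableSpace Ω] {μ : Measure Ω}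
    [IsFiniteMeasure μ] {X : ℕ → Ω → ℕ} {c : ℕ} (hX : ∀ n, MeasurableSet {ω | X n ω = c}) {q : ℝ}
    (hq : Tendsto (fun n => μ.real {ω | X n ω = c}) atTop (𝓝 q)) :
    Tendsto (fun n : ℕ => (∫ ω, (letterCount (fun k => X k ω) c n : ℝ) ∂μ) / (n : ℝ)) atTop
      (𝓝 q) := by
  refine hq.cesaro.congr fun n => ?_
  have hcount : ∀ ω, (letterCount (fun k => X k ω) c n : ℝ) =
      ∑ i ∈ Finset.range n, {ω | X i ω = c}.indicator (fun _ => 1) ω := fun ω => by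
    simp [letterCount, Set.indicator_apply]
  simp_rw [hcount]
  rw [integral_finsetSum _ fun i _ => (integrable_const (1 : ℝ)).indicator (hX i), div_eq_inv_mul]
  simp_rw [integral_indicator_const (1 : ℝ) (hX _), smul_eq_mul, mul_one]

section DirectedMarkovChain

variable {S : Set ℕ} {Ω : Type*} [MeasurableSpace Ω] {μ : Measure Ω} {T : ℕ → Ω → S}

theorem measurableSet_directedSeq_eq (hT : ∀ i, Measurable (T i)) (n c : ℕ) :
    MeasurableSet {ω | directedSeq (fun k => T k ω) n = c} :=
  (measurable_comp_of_dependsOn hT (f := fun s : ℕ → S => directedSeq (fun k => s k) n)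
    fun _ _ h => dependsOn_directedSeq n fun i hi => congrArg Subtype.val (h i hi))
    (measurableSet_singleton c)

theorem dependsOn_isEarlyBlock_coe (m n j : ℕ) :
    DependsOn (fun s : ℕ → S => IsEarlyBlock m n j fun i => s i) (Set.Iic j) :=
  fun _ _ h => dependsOn_isEarlyBlock m n j fun i hi => congrArg Subtype.val (h i hi)

theorem measurableSet_isEarlyBlock (hT : ∀ i, Measurable (T i)) (m n j : ℕ) :
    MeasurableSet {ω | IsEarlyBlock m n j fun i => T i ω} :=
  measurableSet_of_dependsOn hT (dependsOn_isEarlyBlock_coe m n j)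

theorem tendsto_measureReal_compl_isEarlyBlock [IsFiniteMeasure μ] (hT : ∀ i, Measurable (T i))
    (hlarge : ∀ᵐ ω ∂μ, ∃ᶠ i in atTop, 1 < (T i ω : ℕ)) (m : ℕ) :
    Tendsto (fun n => μ.real (⋃ j ∈ Finset.Iic n, {ω | IsEarlyBlock m n j fun i => T i ω})ᶜ)
      atTop (𝓝 0) := by
  have hlim := tendsto_measure_of_ae_tendsto_indicator_of_isFiniteMeasure (μ := μ) (A := ∅)
    (As := fun n => (⋃ j ∈ Finset.Iic n, {ω | IsEarlyBlock m n j fun i => T i ω})ᶜ) atTop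
    MeasurableSet.empty
    (fun n => (Finset.measurableSet_biUnion _ fun j _ => measurableSet_isEarlyBlock hT m n j).compl)
    (by
      filter_upwards [hlarge] with ω hω
      filter_upwards [eventually_exists_isEarlyBlock hω m] with n hn
      simpa using hn)
  rw [measure_empty] at hlim
  exact (ENNReal.tendsto_toReal ENNReal.zero_ne_top).comp hlim

namespace IsMarkovChain

variable {K : S → S → ℝ} {s₀ c : S} {q : ℝ}

theorem ae_frequently_one_lt [IsFiniteMeasure μ] [Finite S] (hT : IsMarkovChain μ K s₀ T)
    (hS : ∀ x ∈ S, 1 ≤ x) (hK : ∀ x : S, (x : ℕ) = 1 → K x x ≠ 1) :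
    ∀ᵐ ω ∂μ, ∃ᶠ i in atTop, 1 < (T i ω : ℕ) := by
  by_cases h1 : 1 ∈ S
  · filter_upwards [hT.ae_frequently_ne (hK ⟨1, h1⟩ rfl)] with ω hω
    refine hω.mono fun i hi => lt_of_le_of_ne (hS _ (T i ω).2) fun h => hi (Subtype.ext h.symm)
  · refine ae_of_all _ fun ω => Frequently.of_forall fun i =>
      lt_of_le_of_ne (hS _ (T i ω).2) fun h => h1 (h ▸ (T i ω).2)

variable [IsProbabilityMeasure μ] [Fintype S]

theorem abs_measureReal_directedSeq_eq_sub_le (hT : IsMarkovChain μ K s₀ T) {m : ℕ} {ε : ℝ}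
    (hK : ∀ x, |(Matrix.of K ^ m) x c - q| ≤ ε) (n : ℕ) :
    |μ.real {ω | directedSeq (fun k => T k ω) n = c} - q| ≤
      ε + (1 + |q|) *
        μ.real (⋃ j ∈ Finset.Iic n, {ω | IsEarlyBlock m n j fun i => T i ω})ᶜ := by
  refine abs_measureReal_sub_le_of_pairwiseDisjoint
    (fun j _ j' _ hne => Set.disjoint_left.mpr fun ω hj hj' => hne (hj.unique hj'))
    (fun j _ => measurableSet_isEarlyBlock hT.measurable m n j) (fun j _ => ?_)
    ((abs_nonneg _).trans (hK c))
  have hinter : {ω | IsEarlyBlock m n j fun i => T i ω} ∩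
      {ω | directedSeq (fun k => T k ω) n = c} =
      {ω | IsEarlyBlock m n j fun i => T i ω} ∩ T (j + m) ⁻¹' {c} := by
    ext ω
    refine and_congr_right fun hω => ?_
    rw [Set.mem_ofPred_eq, hω.directedSeq_eq]
    exact Subtype.ext_iff.symm
  rw [hinter]
  exact hT.abs_measureReal_inter_add_sub_le (dependsOn_isEarlyBlock_coe m n j) hK

theorem tendsto_measureReal_directedSeq_eq (hT : IsMarkovChain μ K s₀ T)
    (hlarge : ∀ᵐ ω ∂μ, ∃ᶠ i in atTop, 1 < (T i ω : ℕ))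
    (hK : ∀ x, Tendsto (fun m => (Matrix.of K ^ m) x c) atTop (𝓝 q)) :
    Tendsto (fun n => μ.real {ω | directedSeq (fun k => T k ω) n = c}) atTop (𝓝 q) := by
  rw [Metric.tendsto_atTop']
  intro ε hε
  obtain ⟨m, hm⟩ : ∃ m, ∀ x, |(Matrix.of K ^ m) x c - q| ≤ ε / 2 :=
    (eventually_all.mpr fun x =>
      (hK x).eventually (Metric.closedBall_mem_nhds q (half_pos hε))).exists
  have hzero := (tendsto_measureReal_compl_isEarlyBlock hT.measurable hlarge m).const_mul (1 + |q|)
  rw [mul_zero] at hzero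
  obtain ⟨N, hN⟩ := eventually_atTop.mp (hzero.eventually (gt_mem_nhds (half_pos hε)))
  refine ⟨N, fun n hn => ?_⟩
  rw [Real.dist_eq]
  linarith [hT.abs_measureReal_directedSeq_eq_sub_le hm n, hN n hn.le]

end IsMarkovChain

end DirectedMarkovChain

theorem flipKernel_pow_apply {a : ℕ} (ha : a ≠ 1) (p : ℝ) (m : ℕ) (x y : ({1, a} : Set ℕ)) :
    (Matrix.of (flipKernel a p) ^ m) x y =
      (1 - 2 * p) ^ m * (if x = y then 1 else 0) + (1 - (1 - 2 * p) ^ m) / 2 := by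
  have hcard : Fintype.card ({1, a} : Set ℕ) = 2 := by simp [ha.symm]
  have hflip : ∀ x y : ({1, a} : Set ℕ),
      flipKernel a p x y = (1 - 2 * p) * (if x = y then 1 else 0) + p := fun x y => by
    unfold flipKernel; split_ifs <;> ring
  induction m generalizing y with
  | zero => simp [Matrix.one_apply]
  | succ m ih =>
    simp_rw [pow_succ, Matrix.mul_apply, ih, Matrix.of_apply, hflip, add_mul, mul_add,
      Finset.sum_add_distrib]
    simp only [mul_ite, mul_one, mul_zero, ite_mul, zero_mul, Finset.sum_ite_eq', Finset.mem_univ,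
      ↓reduceIte, Finset.sum_ite_eq, Finset.sum_const, Finset.card_univ, hcard, nsmul_eq_mul,
      Nat.cast_ofNat]
    ring

theorem tendsto_flipKernel_pow_apply {a : ℕ} (ha : a ≠ 1) {p : ℝ} (hp : p ∈ Set.Ioo (0 : ℝ) 1)
    (x y : ({1, a} : Set ℕ)) :
    Tendsto (fun m => (Matrix.of (flipKernel a p) ^ m) x y) atTop (𝓝 (1 / 2)) := by
  have hpow : Tendsto (fun m : ℕ => (1 - 2 * p) ^ m) atTop (𝓝 0) :=
    tendsto_pow_atTop_nhds_zero_of_abs_lt_one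
      (abs_lt.mpr ⟨by linarith [hp.2], by linarith [hp.1]⟩)
  simp_rw [flipKernel_pow_apply ha]
  simpa using (hpow.mul_const (if x = y then 1 else 0)).add ((hpow.const_sub 1).div_const 2)

theorem mainTheorem6_general {S : Set ℕ} [Fintype S] (hS : ∀ x ∈ S, 1 ≤ x) {K : S → S → ℝ}
    (hK : ∀ x : S, (x : ℕ) = 1 → K x x ≠ 1) {c : S} {q : ℝ}
    (hq : ∀ x, Tendsto (fun m => (Matrix.of K ^ m) x c) atTop (𝓝 q))
    {Ω : Type*} [MeasurableSpace Ω] {μ : Measure Ω} [IsProbabilityMeasure μ]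
    {s₀ : S} {T : ℕ → Ω → S} (hT : IsMarkovChain μ K s₀ T)
    {X : ℕ → Ω → ℕ} (hX : ∀ n ω, X n ω = directedSeq (fun k => T k ω) n) :
    Tendsto (fun n => μ.real {ω | X n ω = c}) atTop (𝓝 q) ∧
    Tendsto (fun n : ℕ => (∫ ω, (letterCount (fun k => X k ω) c n : ℝ) ∂μ) / (n : ℝ))
      atTop (𝓝 q) := by
  obtain rfl : X = fun n ω => directedSeq (fun k => T k ω) n := funext₂ hX
  have hprob := hT.tendsto_measureReal_directedSeq_eq (hT.ae_frequently_one_lt hS hK) hq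
  exact ⟨hprob, tendsto_integral_letterCount_div
    (fun n => measurableSet_directedSeq_eq hT.measurable n c) hprob⟩

theorem mainTheorem6 (a : ℕ) (ha : 2 ≤ a) (p : ℝ) (hp : p ∈ Set.Ioo (0 : ℝ) 1)
    {Ω : Type*} [MeasurableSpace Ω] (μ : MeasureTheory.Measure Ω)
    [MeasureTheory.IsProbabilityMeasure μ]
    (T : ℕ → Ω → ({1, a} : Set ℕ))
    (hT : IsMarkovChain μ (flipKernel a p) ⟨1, Set.mem_insert 1 {a}⟩ T)
    (X : ℕ → Ω → ℕ) (hX : ∀ n ω, X n ω = directedSeq (fun k => (T k ω : ℕ)) n) :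
    Filter.Tendsto (fun n : ℕ => μ.real {ω | X n ω = 1}) Filter.atTop (nhds (1 / 2)) ∧
    Filter.Tendsto
      (fun n : ℕ => (∫ ω, (letterCount (fun k => X k ω) 1 n : ℝ) ∂μ) / (n : ℝ))
      Filter.atTop (nhds (1 / 2)) := by
  have hpos : ∀ x ∈ ({1, a} : Set ℕ), 1 ≤ x := by
    rintro x (rfl | rfl) <;> omega
  exact mainTheorem6_general (c := ⟨1, Set.mem_insert 1 {a}⟩) hpos
    (fun x _ => by simp [flipKernel, hp.1.ne'])
    (fun x => tendsto_flipKernel_pow_apply (by omega) hp x _) hT hX
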